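/- **Conventions.** For a finitely generated module $V$ over a ring $S$, let $d_S(V)$ be the least number of elements generating $V$; for a group $G$ write $d_G$ for $d_{\mathbb{Z}G}$. For a group $A$ (in particular, for the additive group of a module) let $\pi(A)$ be the set of primes dividing the order of some finite subgroup of $A$. Let $M$ be a finitely generated $\mathbb{Z}G$-module and $\pi$ a finite set of primes. For $X\subseteq M$ let $X\mathbb{Z}G$ be the submodule of $M$ generated by $X$. A *nested $\pi$-family* in $M$ is a family $(X_p)_{p\in\pi}$ of subsets of $M$ such that each $X_p$ generates $M$ modulo $pM$ as a $\mathbb{Z}G$-module and has exactly $d_G(M/pM)$ elements, and such that for all $p,q\in\pi$: $X_p\supseteq X_q$ if and only if $d_G(M/pM)\ge d_G(M/qM)$. Its *minimal element* (for $\pi\neq\emptyset$) is the member contained in all the others. Let $\pi_0$ be a finite set of primes. We say that $M$ is *good for $G$ with $\pi(G,M)=\pi_0$* if (g1) there is an integer $\delta$ such that $d_G(M/pM)=\delta$ for all primes $p\notin\pi_0$ and $\delta\le d_G(M/pM)$ for all $p\in\pi_0$; and (g2) for every finite set of primes $\pi$ properly containing $\pi_0$ there is a nested $\pi$-family in $M$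 whose minimal element $X$ satisfies $d_G\bigl(M/(pM+X\mathbb{Z}G)\bigr)\le 1$ for all primes $p\notin\pi$, and such that $M/X\mathbb{Z}G$ is a torsion group of finite exponent. $M$ is *good for $G$* if this holds for some finite set of primes $\pi_0$. **Theorem 7.1.** Let $G$ be a finite group and $M$ a finitely generated $\mathbb{Z}G$-module. 1. For every finite set of primes $\pi$ properly containing $\pi(G)\cup\pi(M)$ there is a nested $\pi$-family in $M$ whose minimal element $X$ satisfies $$d_G\bigl(M/(X\mathbb{Z}G+pM)\bigr)\le 1\quad\text{for every prime } p\notin\pi.$$ 2. Hence $M$ is good for $G$ with $\pi(G,M)=\pi(G)\cup\pi(M)$ (which is a finite set); in particular every finitely generated $\mathbb{Z}G$-module is good for $G$. -/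

import Mathlib

/-- `d_S(V)`: the least number of elements generating the finitely generated `S`-module `V`. -/
noncomputable def genRank (S V : Type*) [Ring S] [AddCommGroup V] [Module S V] : ℕ :=
  (⊤ : Submodule S V).spanFinrank

/-- The submodule `pM = {p • m | m ∈ M}` of the `ℤG`-module `M`. -/
noncomputable def modMul (G M : Type*) [Group G] [AddCommGroup M] [Module (MonoidAlgebra ℤ G) M]
    (p : Nat.Primes) : Submodule (MonoidAlgebra ℤ G) M :=
  LinearMap.range ((p : ℕ) • (LinearMap.id : M →ₗ[MonoidAlgebra ℤ G] M))

/-- `X ℤG`: the `ℤG`-submodule of `M` generated by the subset `X`. -/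
noncomputable def genBy (G : Type*) {M : Type*} [Group G] [AddCommGroup M] [Module (MonoidAlgebra ℤ G) M]
    (X : Set M) : Submodule (MonoidAlgebra ℤ G) M :=
  Submodule.span (MonoidAlgebra ℤ G) X

/-- `d_G(M/pM)`. -/
noncomputable def genRankMod (G M : Type*) [Group G] [AddCommGroup M]
    [Module (MonoidAlgebra ℤ G) M] (p : Nat.Primes) : ℕ :=
  genRank (MonoidAlgebra ℤ G) (M ⧸ modMul G M p)

/-- `π(G)`: the primes dividing the orders of the finite subgroups of `G`. -/
def groupPrimes (G : Type*) [Group G] : Set Nat.Primes :=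
  {p | ∃ H : Subgroup G, Finite H ∧ (p : ℕ) ∣ Nat.card H}

/-- `π(M)`: the primes dividing the orders of the finite subgroups of the additive group `M`. -/
def addGroupPrimes (M : Type*) [AddCommGroup M] : Set Nat.Primes :=
  {p | ∃ H : AddSubgroup M, Finite H ∧ (p : ℕ) ∣ Nat.card H}

/-- A nested `π`-family in the finitely generated `ℤG`-module `M`: every `X p` is a
`ℤG`-generating set of `M` modulo `pM` with the minimum number `d_G(M/pM)` of elements, and
`X p ⊇ X q` if and only if `d_G(M/pM) ≥ d_G(M/qM)`. -/
structure IsNestedFamily (G : Type*) {M : Type*} [Group G] [AddCommGroup M]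
    [Module (MonoidAlgebra ℤ G) M] (π : Finset Nat.Primes) (X : π → Set M) : Prop where
  generates : ∀ p : π, genBy G (X p) ⊔ modMul G M p = ⊤
  card_eq : ∀ p : π, (X p).encard = genRankMod G M p
  nested : ∀ p q : π, X q ⊆ X p ↔ genRankMod G M q ≤ genRankMod G M p

/-- `Y` is the minimal element of the family `X`: a member contained in every member. -/
def IsMinimalElement {M : Type*} {π : Finset Nat.Primes} (X : π → Set M) (Y : Set M) : Prop :=
  (∃ q : π, Y = X q) ∧ ∀ p : π, Y ⊆ X p

/-- The finitely generated `ℤG`-module `M` is good for `G` with `π(G,M) = π₀`. -/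
structure IsGoodWith (G M : Type*) [Group G] [AddCommGroup M] [Module (MonoidAlgebra ℤ G) M]
    [Module.Finite (MonoidAlgebra ℤ G) M] (π₀ : Set Nat.Primes) : Prop where
  finite : π₀.Finite
  g1 : ∃ δ : ℕ, (∀ p ∉ π₀, genRankMod G M p = δ) ∧ ∀ p ∈ π₀, δ ≤ genRankMod G M p
  g2 : ∀ π : Finset Nat.Primes, π₀ ⊂ (π : Set Nat.Primes) →
    ∃ (X : π → Set M) (Y : Set M), IsNestedFamily G π X ∧ IsMinimalElement X Y ∧
      (∀ p ∉ π, genRank (MonoidAlgebra ℤ G) (M ⧸ (modMul G M p ⊔ genBy G Y)) ≤ 1) ∧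
      ∃ n : ℕ, 0 < n ∧ ∀ x : M ⧸ genBy G Y, n • x = 0

/-- The finitely generated `ℤG`-module `M` is good for `G`. -/
def IsGood (G M : Type*) [Group G] [AddCommGroup M] [Module (MonoidAlgebra ℤ G) M]
    [Module.Finite (MonoidAlgebra ℤ G) M] : Prop :=
  ∃ π₀ : Set Nat.Primes, IsGoodWith G M π₀

/-! Two facts carry the proof.

Minimal rank (`genRankMod_le`): let p be outside π(G) ∪ π(M) and let L be generated by d_G(M/qM)
lifts of generators of M/qM. By Nakayama over ℤ, nM ⊆ L for some n ≠ 0. Then L/pL maps onto M/pM: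
factor n into primes; a step at a prime other than p is trivial, and a step at p follows from
Maschke's theorem. So d_G(M/pM) ≤ d_G(M/qM).

Simultaneous lifting (`exists_lift_generators`): the Chinese remainder theorem gives one sequence
x₀, x₁, … lifting generators modulo every p ∈ π. Its initial segments are the nested family. A prime
q ∈ π outside π(G) ∪ π(M) has minimal rank δ. The first δ terms generate modulo q, hence modulo all
but finitely many primes; replacing them one at a time repairs the exceptional primes, up to a
cyclic quotient. -/

theorem exists_leftInverse_of_prime_smul_eq_zero {V W : Type*} [AddCommGroup V] [AddCommGroup W]
    {p : ℕ} [Fact p.Prime] (hW : ∀ w : W, p • w = 0) (hV : ∀ v : V, p • v = 0) (f : W →+ V)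
    (hf : Function.Injective f) : ∃ g : V →+ W, ∀ w, g (f w) = w := by
  let _ : Module (ZMod p) V := AddCommGroup.zmodModule hV
  let _ : Module (ZMod p) W := AddCommGroup.zmodModule hW
  obtain ⟨g, hg⟩ := (f.toZModLinearMap p).exists_leftInverse_of_injective
    (LinearMap.ker_eq_bot.2 hf)
  exact ⟨g.toAddMonoidHom, fun w ↦ LinearMap.congr_fun hg w⟩

/-- Maschke's theorem for `ℤG`-modules of prime exponent not dividing `|G|`. -/
theorem isSemisimpleModule_of_prime_smul_eq_zero {G V : Type*} [Group G] [Finite G]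
    [AddCommGroup V] [Module (MonoidAlgebra ℤ G) V] {p : ℕ} [Fact p.Prime]
    (hG : ¬ p ∣ Nat.card G) (hV : ∀ v : V, p • v = 0) :
    IsSemisimpleModule (MonoidAlgebra ℤ G) V := by
  cases nonempty_fintype G
  refine { exists_isCompl := fun W ↦ ?_ }
  have hW : ∀ w : W, p • w = 0 := fun w ↦ Subtype.ext (hV w)
  obtain ⟨g, hg⟩ := exists_leftInverse_of_prime_smul_eq_zero (p := p) hW hV
    W.subtype.toAddMonoidHom W.subtype_injective
  let ρ : V →ₗ[ℤ] W := g.toIntLinearMap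
  have hρ : ∀ w : W, ρ (W.subtype w) = w := hg
  -- Each conjugate of the additive retraction ρ is again a retraction onto W. Below, `a` inverts
  -- |G| modulo p.
  have hsum : ∀ w : W, ρ.sumOfConjugatesEquivariant G (W.subtype w) = Nat.card G • w := fun w ↦ by
    rw [LinearMap.sumOfConjugatesEquivariant_apply,
      Finset.sum_congr rfl fun h _ ↦ LinearMap.conjugate_i ρ W.subtype hρ h w]
    simp
  have hcop : IsCoprime (Nat.card G : ℤ) p :=
    Nat.isCoprime_iff_coprime.2 ((Nat.Prime.coprime_iff_not_dvd Fact.out).2 hG).symm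
  obtain ⟨a, b, hab⟩ := hcop
  refine ⟨_, LinearMap.isCompl_of_proj (f := a • ρ.sumOfConjugatesEquivariant G) fun w ↦ ?_⟩
  have h1 := hsum w
  rw [Submodule.subtype_apply] at h1
  rw [LinearMap.smul_apply, h1, ← natCast_zsmul, smul_smul]
  have h2 : (a * (Nat.card G : ℤ)) = 1 - b * p := by linarith
  rw [h2, sub_smul, mul_smul, natCast_zsmul, hW, smul_zero, sub_zero, one_smul]

/-! ### Comparing L/pL with M/pM for a submodule L of M -/

section

variable {G M L : Type*} [Group G] [AddCommGroup M] [Module (MonoidAlgebra ℤ G) M]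
  [AddCommGroup L] [Module (MonoidAlgebra ℤ G) L]

theorem mem_modMul {p : Nat.Primes} {x : M} : x ∈ modMul G M p ↔ ∃ y : M, (p : ℕ) • y = x :=
  Iff.rfl

theorem smul_mem_modMul (p : Nat.Primes) (x : M) : (p : ℕ) • x ∈ modMul G M p :=
  mem_modMul.2 ⟨x, rfl⟩

theorem modMul_le_comap (p : Nat.Primes) (i : L →ₗ[MonoidAlgebra ℤ G] M) :
    modMul G L p ≤ (modMul G M p).comap i := by
  intro x hx
  obtain ⟨y, rfl⟩ := mem_modMul.1 hx
  rw [Submodule.mem_comap, map_nsmul]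
  exact smul_mem_modMul p _

theorem isSemisimpleModule_quotient_modMul [Finite G] {p : Nat.Primes}
    (hG : ¬ (p : ℕ) ∣ Nat.card G) : IsSemisimpleModule (MonoidAlgebra ℤ G) (M ⧸ modMul G M p) := by
  have : Fact (p : ℕ).Prime := ⟨p.2⟩
  refine isSemisimpleModule_of_prime_smul_eq_zero hG fun v ↦ ?_
  obtain ⟨m, rfl⟩ := Submodule.mkQ_surjective _ v
  rw [← map_nsmul, Submodule.mkQ_apply, Submodule.Quotient.mk_eq_zero]
  exact smul_mem_modMul p m

theorem exists_surjective_quotient_modMul_of_ne {p : Nat.Primes} {r : ℕ} (hr : r.Coprime p)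
    (i : L →ₗ[MonoidAlgebra ℤ G] M) (hi : ∀ m : M, r • m ∈ LinearMap.range i) :
    ∃ h : (L ⧸ modMul G L p) →ₗ[MonoidAlgebra ℤ G] (M ⧸ modMul G M p),
      Function.Surjective h := by
  refine ⟨Submodule.mapQ _ _ i (modMul_le_comap p i), fun v ↦ ?_⟩
  obtain ⟨m, rfl⟩ := Submodule.mkQ_surjective _ v
  obtain ⟨a, b, hab⟩ := Nat.isCoprime_iff_coprime.2 hr
  obtain ⟨l, hl⟩ := hi m
  refine ⟨Submodule.mkQ _ (a • l), ?_⟩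
  rw [Submodule.mkQ_apply, Submodule.mapQ_apply, Submodule.mkQ_apply, Submodule.Quotient.eq,
    map_zsmul, hl]
  have h : a • r • m - m = (p : ℕ) • (-b • m) := by
    rw [← natCast_zsmul, ← natCast_zsmul, smul_smul, smul_smul]
    conv_lhs => rw [← one_smul ℤ m, smul_smul, ← sub_smul]
    congr 1
    linarith
  rw [h]
  exact smul_mem_modMul p _

/-- If `pM ⊆ L ⊆ M`, then `M/pM` is a quotient of `L/pL`, for `p` not dividing `|G|` and `M`
without `p`-torsion. -/
theorem exists_surjective_quotient_modMul_of_eq [Finite G] {p : Nat.Primes}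
    (hG : ¬ (p : ℕ) ∣ Nat.card G) (hM : ∀ m : M, (p : ℕ) • m = 0 → m = 0)
    (i : L →ₗ[MonoidAlgebra ℤ G] M) (hinj : Function.Injective i)
    (hi : ∀ m : M, (p : ℕ) • m ∈ LinearMap.range i) :
    ∃ h : (L ⧸ modMul G L p) →ₗ[MonoidAlgebra ℤ G] (M ⧸ modMul G M p),
      Function.Surjective h := by
  have := isSemisimpleModule_quotient_modMul (M := M) hG
  have := isSemisimpleModule_quotient_modMul (M := L) hG
  -- Multiplication by p as a map M → L. It embeds M/L in L/pL, since without p-torsion pm ∈ pL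
  -- forces m ∈ L.
  let t : M →ₗ[MonoidAlgebra ℤ G] L := (LinearEquiv.ofInjective i hinj).symm.toLinearMap ∘ₗ
    ((p : ℕ) • (LinearMap.id : M →ₗ[MonoidAlgebra ℤ G] M)).codRestrict (LinearMap.range i) hi
  have ht : ∀ m, i (t m) = (p : ℕ) • m := fun m ↦ by
    rw [← LinearEquiv.ofInjective_apply (h := hinj)]
    simp [t]
  let j : M →ₗ[MonoidAlgebra ℤ G] (L ⧸ modMul G L p) := (modMul G L p).mkQ ∘ₗ t
  have hj : LinearMap.ker j = LinearMap.range i := by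
    ext m
    rw [LinearMap.mem_ker, LinearMap.comp_apply, Submodule.mkQ_apply,
      Submodule.Quotient.mk_eq_zero, mem_modMul]
    constructor
    · rintro ⟨l, hl⟩
      refine ⟨l, sub_eq_zero.1 (hM _ ?_)⟩
      rw [smul_sub, ← map_nsmul, hl, ht, sub_self]
    · rintro ⟨l, rfl⟩
      exact ⟨l, hinj (by rw [ht, map_nsmul])⟩
  let jbar := (LinearMap.range i).liftQ j hj.ge
  have hjbar : Function.Injective jbar :=
    LinearMap.ker_eq_bot.1 (Submodule.ker_liftQ_eq_bot _ _ _ hj.le)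
  have hle : modMul G M p ≤ LinearMap.range i := by
    rintro _ ⟨m, rfl⟩
    exact hi m
  let q := Submodule.factor hle
  have hq : Function.Surjective q := Submodule.factor_surjective hle
  obtain ⟨s, hs⟩ := IsSemisimpleModule.lifting_property q hq LinearMap.id
  obtain ⟨ρ, hρ⟩ := IsSemisimpleModule.extension_property jbar hjbar LinearMap.id
  let ibar := Submodule.mapQ _ _ i (modMul_le_comap p i)
  have hs' : ∀ x, q (s x) = x := fun x ↦ LinearMap.congr_fun hs x
  have hρ' : ∀ m, ρ (j m) = (LinearMap.range i).mkQ m := fun m ↦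
    LinearMap.congr_fun hρ ((LinearMap.range i).mkQ m)
  have hibar : ∀ m, ibar (j m) = 0 := fun m ↦ by
    change (modMul G M p).mkQ (i (t m)) = 0
    rw [ht, Submodule.mkQ_apply, Submodule.Quotient.mk_eq_zero]
    exact smul_mem_modMul p m
  -- Both modules are built from M/L and L/pM, in opposite orders. `ibar` maps onto L/pM and kills
  -- the copy of M/L in L/pL; `ρ` splits off that copy and `s` sends it to a complement of L/pM in
  -- M/pM.
  refine ⟨ibar + s ∘ₗ ρ, fun v ↦ ?_⟩
  obtain ⟨m₁, hm₁⟩ := Submodule.mkQ_surjective _ (v - s (q v))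
  have h0 : q ((modMul G M p).mkQ m₁) = 0 := by rw [hm₁, map_sub, hs', sub_self]
  obtain ⟨l, hl⟩ : m₁ ∈ LinearMap.range i := (Submodule.Quotient.mk_eq_zero _).1 h0
  obtain ⟨m, hm⟩ := (LinearMap.range i).mkQ_surjective (q v - ρ ((modMul G L p).mkQ l))
  refine ⟨(modMul G L p).mkQ l + j m, ?_⟩
  have h1 : ibar ((modMul G L p).mkQ l) = v - s (q v) := by
    rw [← hm₁, ← hl]; rfl
  simp only [LinearMap.add_apply, LinearMap.comp_apply, map_add, hibar, hρ', hm, h1, map_sub]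
  abel

end

/-- If `n • M ⊆ L ⊆ M`, then `M/pM` is a quotient of `L/pL`, for `p` not dividing `|G|` and `M`
without `p`-torsion. -/
theorem exists_surjective_quotient_modMul.{u, v} {G : Type u} [Group G] [Finite G] {p : Nat.Primes}
    (hG : ¬ (p : ℕ) ∣ Nat.card G) (n : ℕ) :
    ∀ (M L : Type v) [AddCommGroup M] [Module (MonoidAlgebra ℤ G) M]
      [AddCommGroup L] [Module (MonoidAlgebra ℤ G) L] (i : L →ₗ[MonoidAlgebra ℤ G] M),
      n ≠ 0 → (∀ m : M, (p : ℕ) • m = 0 → m = 0) → Function.Injective i →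
      (∀ m : M, n • m ∈ LinearMap.range i) →
      ∃ h : (L ⧸ modMul G L p) →ₗ[MonoidAlgebra ℤ G] (M ⧸ modMul G M p),
        Function.Surjective h := by
  induction n using Nat.recOnMul with
  | zero => intro _ _ _ _ _ _ _ h; exact absurd rfl h
  | one =>
    intro M L _ _ _ _ i _ _ _ hi
    exact exists_surjective_quotient_modMul_of_ne (Nat.coprime_one_left _) i hi
  | prime r hr =>
    intro M L _ _ _ _ i _ hM hinj hi
    rcases eq_or_ne r p with rfl | hne
    · exact exists_surjective_quotient_modMul_of_eq hG hM i hinj hi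
    · exact exists_surjective_quotient_modMul_of_ne ((Nat.coprime_primes hr p.2).2 hne) i hi
  | mul a b ha hb =>
    intro M L _ _ _ _ i hab hM hinj hi
    -- N = L + bM lies between L and M, with b killing M/N and a killing N/L.
    let N : Submodule (MonoidAlgebra ℤ G) M :=
      LinearMap.range i ⊔ LinearMap.range (b • (LinearMap.id : M →ₗ[MonoidAlgebra ℤ G] M))
    let k : L →ₗ[MonoidAlgebra ℤ G] N :=
      i.codRestrict N fun l ↦ Submodule.mem_sup_left ⟨l, rfl⟩
    obtain ⟨f, hf⟩ := hb M N N.subtype (right_ne_zero_of_mul hab) hM N.subtype_injective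
      fun m ↦ by
        rw [Submodule.range_subtype]
        exact Submodule.mem_sup_right ⟨m, rfl⟩
    obtain ⟨g, hg⟩ := ha N L k (left_ne_zero_of_mul hab)
      (fun m h ↦ Subtype.ext (hM m (congrArg Subtype.val h)))
      (fun x y h ↦ hinj (congrArg Subtype.val h)) fun m ↦ by
        obtain ⟨_, ⟨l, rfl⟩, _, ⟨y, rfl⟩, h⟩ := Submodule.mem_sup.1 m.2
        obtain ⟨l', hl'⟩ := hi y
        refine ⟨a • l + l', Subtype.ext ?_⟩
        change i (a • l + l') = a • (m : M)
        rw [← h, map_add, hl', map_nsmul, smul_add, mul_smul]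
        rfl
    exact ⟨f ∘ₗ g, hf.comp hg⟩

/-! ### Numbers of generators of quotients -/

section Generators

variable {R M : Type*} [Ring R] [AddCommGroup M] [Module R M]

theorem span_sup_le_of_sub_mem {N : Submodule R M} {s : Set ℕ} {x y : ℕ → M}
    (h : ∀ i ∈ s, y i - x i ∈ N) :
    Submodule.span R (y '' s) ⊔ N ≤ Submodule.span R (x '' s) ⊔ N := by
  refine sup_le (Submodule.span_le.2 ?_) le_sup_right
  rintro _ ⟨i, hi, rfl⟩
  rw [← sub_add_cancel (y i) (x i)]
  exact add_mem (Submodule.mem_sup_right (h i hi))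
    (Submodule.mem_sup_left (Submodule.subset_span ⟨i, hi, rfl⟩))

theorem genRank_quotient_le_ncard {N : Submodule R M} {s : Set M} (hs : s.Finite)
    (h : Submodule.span R s ⊔ N = ⊤) : genRank R (M ⧸ N) ≤ s.ncard := by
  have h1 : Submodule.span R (N.mkQ '' s) = ⊤ := by
    rw [← Submodule.map_span]
    exact (Submodule.map_mkQ_eq_top N _).2 (sup_comm _ N ▸ h)
  rw [genRank, ← h1]
  exact (Submodule.spanFinrank_span_le_ncard_of_finite (hs.image _)).trans
    (Set.ncard_image_le hs)

variable [Module.Finite R M]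

/-- Sequences, padded with zeros, replace generating sets: terms can then be changed one by one, and
initial segments are nested. -/
theorem exists_span_image_Iio_sup_eq_top (N : Submodule R M) {n : ℕ}
    (h : genRank R (M ⧸ N) ≤ n) : ∃ x : ℕ → M, Submodule.span R (x '' Set.Iio n) ⊔ N = ⊤ := by
  obtain ⟨s, hs, hspan⟩ :=
    (Module.Finite.fg_top (R := R) (M := M ⧸ N)).exists_span_finset_card_eq_spanFinrank
  have hcard : s.card ≤ n := hs.trans_le h
  let e := s.equivFin
  let g : M ⧸ N → M := Function.surjInv N.mkQ_surjective
  refine ⟨fun i ↦ if hi : i < s.card then g (e.symm ⟨i, hi⟩) else 0, ?_⟩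
  rw [sup_comm, ← Submodule.map_mkQ_eq_top, eq_top_iff, ← hspan, Submodule.map_span]
  refine Submodule.span_mono fun v hv ↦ ?_
  refine ⟨g v, ⟨e ⟨v, hv⟩, (e ⟨v, hv⟩).2.trans_le hcard, ?_⟩, Function.surjInv_eq _ v⟩
  simp

theorem genRank_quotient_le_iff (N : Submodule R M) {n : ℕ} :
    genRank R (M ⧸ N) ≤ n ↔ ∃ x : ℕ → M, Submodule.span R (x '' Set.Iio n) ⊔ N = ⊤ := by
  refine ⟨exists_span_image_Iio_sup_eq_top N, fun ⟨x, hx⟩ ↦ ?_⟩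
  refine (genRank_quotient_le_ncard ((Set.finite_Iio n).image x) hx).trans ?_
  refine (Set.ncard_image_le (Set.finite_Iio n)).trans ?_
  simp

theorem genRank_quotient_anti {N N' : Submodule R M} (h : N ≤ N') :
    genRank R (M ⧸ N') ≤ genRank R (M ⧸ N) := by
  obtain ⟨x, hx⟩ := (genRank_quotient_le_iff N).1 le_rfl
  exact (genRank_quotient_le_iff N').2
    ⟨x, top_unique (hx.ge.trans (sup_le_sup_left h _))⟩

/-- Some element lowers the number of generators of a quotient by one. -/
theorem exists_genRank_quotient_span_singleton_sup_le (N : Submodule R M) {n : ℕ}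
    (h : genRank R (M ⧸ N) ≤ n + 1) :
    ∃ z : M, genRank R (M ⧸ (Submodule.span R {z} ⊔ N)) ≤ n := by
  obtain ⟨x, hx⟩ := (genRank_quotient_le_iff N).1 h
  refine ⟨x n, (genRank_quotient_le_iff _).2 ⟨x, ?_⟩⟩
  rw [← hx, ← sup_assoc, ← Submodule.span_union]
  congr 2
  ext m
  simp only [Set.mem_union, Set.mem_image, Set.mem_Iio, Set.mem_singleton_iff]
  constructor
  · rintro (⟨i, hi, rfl⟩ | rfl)
    · exact ⟨i, by omega, rfl⟩
    · exact ⟨n, by omega, rfl⟩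
  · rintro ⟨i, hi, rfl⟩
    rcases Nat.lt_succ_iff_lt_or_eq.1 hi with h | rfl
    · exact Or.inl ⟨i, h, rfl⟩
    · exact Or.inr rfl

theorem genRank_le_of_surjective {P : Type*} [AddCommGroup P] [Module R P] {f : M →ₗ[R] P}
    (hf : Function.Surjective f) : genRank R P ≤ genRank R M := by
  rw [genRank, genRank, ← LinearMap.range_eq_top.2 hf, LinearMap.range_eq_map]
  exact Submodule.spanFinrank_map_le_of_fg f Module.Finite.fg_top

end Generators

/-! ### Chinese remainders, Nakayama and simultaneous lifting -/

section

variable {G M : Type*} [Group G] [AddCommGroup M] [Module (MonoidAlgebra ℤ G) M]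

theorem exists_forall_sub_mem_modMul (z : Nat.Primes → M) (T : Finset Nat.Primes) :
    ∃ w : M, ∀ p ∈ T, w - z p ∈ modMul G M p := by
  induction T using Finset.induction_on with
  | empty => exact ⟨0, by simp⟩
  | insert p T hp ih =>
    obtain ⟨w, hw⟩ := ih
    have hcop : Nat.Coprime (p : ℕ) (∏ q ∈ T, (q : ℕ)) := Nat.Coprime.prod_right fun q hq ↦
      (Nat.coprime_primes p.2 q.2).2 fun h ↦ hp (by rwa [Subtype.ext h])
    obtain ⟨a, b, hab⟩ := Nat.isCoprime_iff_coprime.2 hcop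
    set P := ∏ q ∈ T, (q : ℕ) with hP
    refine ⟨w + (P : ℤ) • b • (z p - w), fun q hq ↦ ?_⟩
    rcases Finset.mem_insert.1 hq with rfl | hq
    · have h : w + (P : ℤ) • b • (z q - w) - z q = (q : ℕ) • a • (w - z q) := by
        have hb : (P : ℤ) * b = 1 - a * (q : ℕ) := by linarith
        rw [smul_smul, hb, ← natCast_zsmul (a • _), smul_smul]
        module
      rw [h]
      exact smul_mem_modMul q _
    · obtain ⟨c, hc⟩ := Finset.dvd_prod_of_mem (fun q : Nat.Primes ↦ (q : ℕ)) hq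
      have h : w + (P : ℤ) • b • (z p - w) - z q =
          (w - z q) + (q : ℕ) • c • b • (z p - w) := by
        rw [← hP] at hc
        rw [hc, natCast_zsmul, mul_smul]
        abel
      rw [h]
      exact add_mem (hw q hq) (smul_mem_modMul q _)

theorem sup_modMul_eq_top_of_coprime {L : Submodule (MonoidAlgebra ℤ G) M} {p : Nat.Primes}
    {n : ℕ} (hn : n.Coprime p) (h : ∀ m : M, n • m ∈ L) : L ⊔ modMul G M p = ⊤ := by
  refine eq_top_iff.2 fun m _ ↦ ?_
  obtain ⟨a, b, hab⟩ := Nat.isCoprime_iff_coprime.2 hn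
  have h1 : m = a • n • m + (p : ℕ) • b • m := by
    rw [← natCast_zsmul, ← natCast_zsmul, smul_smul, smul_smul, ← add_smul, mul_comm (p : ℤ), hab,
      one_smul]
  rw [h1]
  exact add_mem (Submodule.mem_sup_left (zsmul_mem (h m) a))
    (Submodule.mem_sup_right (smul_mem_modMul p _))

variable [Finite G] [Module.Finite (MonoidAlgebra ℤ G) M]

/-- As G is finite, M/L is finitely generated over ℤ, and it equals its multiple by q. Nakayama
gives an integer r ≡ 1 mod q annihilating it; the congruence forces r ≠ 0. -/
theorem exists_smul_mem_of_sup_modMul_eq_top {L : Submodule (MonoidAlgebra ℤ G) M}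
    {q : Nat.Primes} (h : L ⊔ modMul G M q = ⊤) : ∃ n : ℕ, n ≠ 0 ∧ ∀ m : M, n • m ∈ L := by
  have hfin : Module.Finite ℤ (M ⧸ L) := Module.Finite.trans (MonoidAlgebra ℤ G) (M ⧸ L)
  obtain ⟨r, hr, hr'⟩ := Submodule.exists_sub_one_mem_and_smul_eq_zero_of_fg_of_le_smul
    (Ideal.span {(q : ℤ)}) (⊤ : Submodule ℤ (M ⧸ L)) hfin.fg_top fun v _ ↦ by
      obtain ⟨m, rfl⟩ := Submodule.mkQ_surjective _ v
      obtain ⟨l, hl, _, ⟨y, rfl⟩, hm⟩ := Submodule.mem_sup.1 (h.ge (Submodule.mem_top (x := m)))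
      have h1 : L.mkQ m = (q : ℤ) • L.mkQ y := by
        rw [← map_zsmul, ← sub_eq_zero, ← map_sub, Submodule.mkQ_apply,
          Submodule.Quotient.mk_eq_zero, ← hm]
        simpa using hl
      rw [h1]
      exact Submodule.smul_mem_smul (Ideal.mem_span_singleton_self _) Submodule.mem_top
  have hr0 : r ≠ 0 := by
    rintro rfl
    rw [Ideal.mem_span_singleton, zero_sub, dvd_neg] at hr
    exact q.2.one_lt.ne' (by exact_mod_cast Int.natAbs_dvd_natAbs.2 hr |> Nat.dvd_one.1)
  refine ⟨r.natAbs, Int.natAbs_ne_zero.2 hr0, fun m ↦ ?_⟩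
  have h1 : r • m ∈ L := by
    have := hr' (L.mkQ m) Submodule.mem_top
    rwa [← map_zsmul, Submodule.mkQ_apply, Submodule.Quotient.mk_eq_zero] at this
  rw [← natCast_zsmul]
  rcases Int.natAbs_eq r with hr | hr
  · rwa [← hr]
  · rw [← neg_mem_iff, ← neg_smul, ← hr]
    exact h1

theorem finite_setOf_sup_modMul_ne_top {L : Submodule (MonoidAlgebra ℤ G) M}
    {q : Nat.Primes} (h : L ⊔ modMul G M q = ⊤) :
    {p : Nat.Primes | L ⊔ modMul G M p ≠ ⊤}.Finite := by
  obtain ⟨n, hn, hnL⟩ := exists_smul_mem_of_sup_modMul_eq_top h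
  refine Set.Finite.subset
    ((n.primeFactors.finite_toSet).preimage (Subtype.val_injective.injOn)) fun p hp ↦ ?_
  by_contra hdvd
  refine hp (sup_modMul_eq_top_of_coprime
    ((Nat.Prime.coprime_iff_not_dvd p.2).2 fun h ↦ hdvd ?_).symm hnL)
  exact Nat.mem_primeFactors.2 ⟨p.2, h, hn⟩

/-- Away from `|G|` and the torsion of `M`, the rank of `M/pM` is minimal. -/
theorem genRankMod_le {p : Nat.Primes} (hG : ¬ (p : ℕ) ∣ Nat.card G)
    (hM : ∀ m : M, (p : ℕ) • m = 0 → m = 0) (q : Nat.Primes) :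
    genRankMod G M p ≤ genRankMod G M q := by
  obtain ⟨x, hx⟩ := (genRank_quotient_le_iff (modMul G M q)).1 le_rfl
  set d := genRank (MonoidAlgebra ℤ G) (M ⧸ modMul G M q) with hd
  have hs : (x '' Set.Iio d).Finite := (Set.finite_Iio d).image x
  set L := Submodule.span (MonoidAlgebra ℤ G) (x '' Set.Iio d) with hL
  have : Module.Finite (MonoidAlgebra ℤ G) L :=
    Module.Finite.iff_fg.2 (Submodule.fg_span hs)
  obtain ⟨n, hn, hnL⟩ := exists_smul_mem_of_sup_modMul_eq_top hx
  obtain ⟨f, hf⟩ := exists_surjective_quotient_modMul hG n M L L.subtype hn hM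
    L.subtype_injective fun m ↦ by rw [Submodule.range_subtype]; exact hnL m
  calc genRankMod G M p ≤ genRank (MonoidAlgebra ℤ G) (L ⧸ modMul G L p) :=
        genRank_le_of_surjective hf
    _ ≤ genRank (MonoidAlgebra ℤ G) L := genRank_le_of_surjective (Submodule.mkQ_surjective _)
    _ = L.spanFinrank := Submodule.spanFinrank_top L
    _ ≤ (x '' Set.Iio d).ncard := Submodule.spanFinrank_span_le_ncard_of_finite hs
    _ ≤ d := (Set.ncard_image_le (Set.finite_Iio d)).trans (by simp)

/-- Generators modulo finitely many primes can be lifted simultaneously to `x₀, x₁, …` in such a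
way that the first `δ` of them generate `M` up to a cyclic quotient modulo every other prime. -/
theorem exists_lift_generators (π : Finset Nat.Primes) (y : Nat.Primes → ℕ → M) {δ : ℕ}
    {q : Nat.Primes} (hq : q ∈ π)
    (hy : genBy G (y q '' Set.Iio δ) ⊔ modMul G M q = ⊤)
    (hδ : ∀ p ∉ π, genRankMod G M p ≤ δ + 1) :
    ∃ x : ℕ → M, (∀ p ∈ π, ∀ i, x i - y p i ∈ modMul G M p) ∧ ∀ p ∉ π,
      genRank (MonoidAlgebra ℤ G) (M ⧸ (genBy G (x '' Set.Iio δ) ⊔ modMul G M p)) ≤ 1 := by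
  -- Each corrected term lowers the bound by one; the initial slack of 1 survives as the final
  -- cyclic quotient.
  suffices H : ∀ i ≤ δ, ∃ x : ℕ → M, (∀ p ∈ π, ∀ i, x i - y p i ∈ modMul G M p) ∧ ∀ p ∉ π,
      genRank (MonoidAlgebra ℤ G) (M ⧸ (genBy G (x '' Set.Iio i) ⊔ modMul G M p)) ≤
        δ - i + 1 by
    simpa using H δ le_rfl
  intro i hi
  induction i with
  | zero =>
    choose x hx using fun i ↦ exists_forall_sub_mem_modMul (G := G) (fun p ↦ y p i) π
    refine ⟨x, fun p hp i ↦ hx i p hp, fun p hp ↦ ?_⟩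
    exact (genRank_quotient_anti le_sup_right).trans (hδ p hp)
  | succ i ih =>
    obtain ⟨x, hxy, hx⟩ := ih (by omega)
    have hgen : genBy G (x '' Set.Iio δ) ⊔ modMul G M q = ⊤ := by
      refine top_unique (hy.ge.trans (span_sup_le_of_sub_mem fun j _ ↦ ?_))
      rw [← neg_sub]
      exact neg_mem (hxy q hq j)
    have hS := finite_setOf_sup_modMul_ne_top hgen
    have hz : ∀ p : Nat.Primes, ∃ z : M, p ∉ π → genRank (MonoidAlgebra ℤ G)
        (M ⧸ (Submodule.span _ {z} ⊔ (genBy G (x '' Set.Iio i) ⊔ modMul G M p))) ≤ δ - i := by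
      intro p
      by_cases hp : p ∈ π
      · exact ⟨0, fun h ↦ absurd hp h⟩
      · obtain ⟨z, hz⟩ := exists_genRank_quotient_span_singleton_sup_le _ (hx p hp)
        exact ⟨z, fun _ ↦ hz⟩
    choose z hz using hz
    classical
    -- The new term keeps its residues at π and lowers the rank at the finitely many primes where
    -- the old first δ terms fail to generate.
    obtain ⟨w, hw⟩ := exists_forall_sub_mem_modMul (G := G)
      (fun p ↦ if p ∈ π then x i else z p) (π ∪ hS.toFinset)
    have himage : Function.update x i w '' Set.Iio (i + 1) = insert w (x '' Set.Iio i) := by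
      rw [show Set.Iio (i + 1) = insert i (Set.Iio i) by ext; simp, Set.image_insert_eq,
        Function.update_self]
      congr 1
      exact Set.image_congr fun j hj ↦ Function.update_of_ne (ne_of_lt hj) _ _
    refine ⟨Function.update x i w, fun p hp j ↦ ?_, fun p hp ↦ ?_⟩
    · rcases eq_or_ne j i with rfl | hj
      · rw [Function.update_self, ← sub_add_sub_cancel w (x j)]
        have := hw p (Finset.mem_union_left _ hp)
        rw [if_pos hp] at this
        exact add_mem this (hxy p hp j)
      · rw [Function.update_of_ne hj]
        exact hxy p hp j
    · rw [himage, show δ - (i + 1) + 1 = δ - i by omega]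
      by_cases hpS : genBy G (x '' Set.Iio δ) ⊔ modMul G M p = ⊤
      -- At the remaining primes the δ - i old terms xᵢ, …, x_{δ-1} generate the quotient, whatever
      -- `w` is. The slack of 1 is what permits keeping the old xᵢ among them.
      · refine (genRank_quotient_le_iff _).2 ⟨fun j ↦ x (i + j), ?_⟩
        refine top_unique (hpS.ge.trans (sup_le (Submodule.span_le.2 ?_) ?_))
        · rintro _ ⟨j, hj, rfl⟩
          rcases lt_or_ge j i with h | h
          · exact Submodule.mem_sup_right (Submodule.mem_sup_left
              (Submodule.subset_span (Set.mem_insert_of_mem _ ⟨j, h, rfl⟩)))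
          · exact Submodule.mem_sup_left (Submodule.subset_span
              ⟨j - i, by simp at hj ⊢; omega, by simp [h]⟩)
        · exact le_sup_of_le_right le_sup_right
      · refine (genRank_quotient_anti ?_).trans (hz p hp)
        have h := hw p (Finset.mem_union_right _ (hS.mem_toFinset.2 hpS))
        rw [if_neg hp] at h
        refine sup_le ?_ (sup_le ?_ le_sup_right)
        · rw [Submodule.span_singleton_le_iff_mem, ← sub_sub_cancel w (z p)]
          exact sub_mem (Submodule.mem_sup_left (Submodule.subset_span (Set.mem_insert _ _)))
            (Submodule.mem_sup_right h)
        · exact le_sup_of_le_left (Submodule.span_mono (Set.subset_insert _ _))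

end

/-! ### The prime sets π(G) and π(M) -/

theorem not_dvd_card_of_notMem_groupPrimes {G : Type*} [Group G] [Finite G] {p : Nat.Primes}
    (hp : p ∉ groupPrimes G) : ¬ (p : ℕ) ∣ Nat.card G := fun h ↦
  hp ⟨⊤, inferInstance, by rwa [Subgroup.card_top]⟩

theorem eq_zero_of_notMem_addGroupPrimes {M : Type*} [AddCommGroup M] {p : Nat.Primes}
    (hp : p ∉ addGroupPrimes M) (m : M) (hm : (p : ℕ) • m = 0) : m = 0 := by
  by_contra h
  have : Fact (p : ℕ).Prime := ⟨p.2⟩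
  have hcard : Nat.card (AddSubgroup.zmultiples m) = p := by
    rw [Nat.card_zmultiples, addOrderOf_eq_prime hm h]
  exact hp ⟨AddSubgroup.zmultiples m,
    Nat.finite_of_card_ne_zero (by rw [hcard]; exact p.2.ne_zero), hcard ▸ dvd_rfl⟩

theorem finite_setOf_prime_dvd {n : ℕ} (hn : n ≠ 0) : {p : Nat.Primes | (p : ℕ) ∣ n}.Finite :=
  (n.primeFactors.finite_toSet.preimage Subtype.val_injective.injOn).subset fun p hp ↦
    Nat.mem_primeFactors.2 ⟨p.2, hp, hn⟩

theorem finite_groupPrimes (G : Type*) [Group G] [Finite G] : (groupPrimes G).Finite :=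
  (finite_setOf_prime_dvd Nat.card_pos.ne').subset fun _ ⟨H, _, hH⟩ ↦
    hH.trans H.card_subgroup_dvd_card

theorem finite_addGroupPrimes (M : Type*) [AddCommGroup M] [Module.Finite ℤ M] :
    (addGroupPrimes M).Finite := by
  let T : Submodule ℤ M := Submodule.torsion ℤ M
  have hT : Finite T := Module.finite_of_fg_torsion T (Submodule.torsion_isTorsion (R := ℤ))
  have : Finite T.toAddSubgroup := hT
  refine (finite_setOf_prime_dvd (n := Nat.card T.toAddSubgroup) Nat.card_pos.ne').subset
    fun p ⟨H, _, hH⟩ ↦ hH.trans (AddSubgroup.card_dvd_of_le (K := T.toAddSubgroup) fun h hh ↦ ?_)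
  refine (Submodule.mem_torsion_iff h).2 ⟨⟨(Nat.card H : ℤ),
    mem_nonZeroDivisors_of_ne_zero (Nat.cast_ne_zero.2 Nat.card_pos.ne')⟩, ?_⟩
  have h1 : Nat.card H • (⟨h, hh⟩ : H) = 0 := card_nsmul_eq_zero'
  change (Nat.card H : ℤ) • h = 0
  rw [natCast_zsmul]
  exact congrArg Subtype.val h1

/-! ### Nested families and goodness -/

section

variable {G M : Type*} [Group G] [AddCommGroup M] [Module (MonoidAlgebra ℤ G) M]

/-- Elements `x₀, x₁, …` whose first `d_G(M/pM)` members generate modulo `p`, for each `p ∈ π`,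
give a nested family. -/
theorem isNestedFamily_image_Iio {π : Finset Nat.Primes} {x : ℕ → M}
    (hx : ∀ p ∈ π, genBy G (x '' Set.Iio (genRankMod G M p)) ⊔ modMul G M p = ⊤) :
    IsNestedFamily G π fun p : π ↦ x '' Set.Iio (genRankMod G M p) := by
  have hcard : ∀ p : π, (x '' Set.Iio (genRankMod G M p)).encard = genRankMod G M p := by
    intro p
    have hfin := (Set.finite_Iio (genRankMod G M p)).image x
    rw [← hfin.cast_ncard_eq, Nat.cast_inj]
    -- Minimality of d_G(M/pM) excludes repetitions among the terms.
    exact ((Set.ncard_image_le (Set.finite_Iio _)).trans (by simp)).antisymm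
      (genRank_quotient_le_ncard hfin (hx p p.2))
  refine ⟨fun p ↦ hx p p.2, hcard, fun p q ↦ ⟨fun h ↦ ?_, fun h ↦ ?_⟩⟩
  · have := Set.encard_le_encard h
    rw [hcard, hcard] at this
    exact_mod_cast this
  · exact Set.image_mono (Set.Iio_subset_Iio h)

variable [Finite G] [Module.Finite (MonoidAlgebra ℤ G) M]

theorem genRankMod_le_of_notMem {p : Nat.Primes} (hp : p ∉ groupPrimes G ∪ addGroupPrimes M)
    (q : Nat.Primes) : genRankMod G M p ≤ genRankMod G M q :=
  genRankMod_le (not_dvd_card_of_notMem_groupPrimes fun h ↦ hp (Or.inl h))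
    (eq_zero_of_notMem_addGroupPrimes fun h ↦ hp (Or.inr h)) q

variable (G M) in
theorem exists_isNestedFamily (π : Finset Nat.Primes)
    (hπ : groupPrimes G ∪ addGroupPrimes M ⊂ (π : Set Nat.Primes)) :
    ∃ (X : π → Set M) (Y : Set M), IsNestedFamily G π X ∧ IsMinimalElement X Y ∧
      ∀ p : Nat.Primes, p ∉ π →
        genRank (MonoidAlgebra ℤ G) (M ⧸ (genBy G Y ⊔ modMul G M p)) ≤ 1 := by
  obtain ⟨q, hqπ, hq⟩ := Set.exists_of_ssubset hπ
  choose y hy using fun p : Nat.Primes ↦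
    exists_span_image_Iio_sup_eq_top (modMul G M p) (le_refl (genRankMod G M p))
  obtain ⟨x, hxy, hx⟩ := exists_lift_generators π y (δ := genRankMod G M q) hqπ (hy q)
    fun p hp ↦
      (genRankMod_le_of_notMem (fun h ↦ hp (hπ.subset h)) q).trans (Nat.le_succ _)
  refine ⟨fun p ↦ x '' Set.Iio (genRankMod G M p), x '' Set.Iio (genRankMod G M q),
    isNestedFamily_image_Iio fun p hp ↦ ?_, ⟨⟨⟨q, hqπ⟩, rfl⟩, fun p ↦ ?_⟩, hx⟩
  · refine top_unique ((hy p).ge.trans (span_sup_le_of_sub_mem fun j _ ↦ ?_))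
    rw [← neg_sub]
    exact neg_mem (hxy p hp j)
  · exact Set.image_mono (Set.Iio_subset_Iio (genRankMod_le_of_notMem hq p))

variable (G M) in
theorem isGoodWith_groupPrimes_union_addGroupPrimes :
    IsGoodWith G M (groupPrimes G ∪ addGroupPrimes M) where
  finite := by
    have : Module.Finite ℤ M := Module.Finite.trans (MonoidAlgebra ℤ G) M
    exact (finite_groupPrimes G).union (finite_addGroupPrimes M)
  g1 := by
    by_cases h : ∃ p, p ∉ groupPrimes G ∪ addGroupPrimes M
    · obtain ⟨p, hp⟩ := h
      exact ⟨genRankMod G M p, fun q hq ↦ (genRankMod_le_of_notMem hq p).antisymm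
        (genRankMod_le_of_notMem hp q),
        fun q _ ↦ genRankMod_le_of_notMem hp q⟩
    · exact ⟨0, fun p hp ↦ absurd ⟨p, hp⟩ h, fun _ _ ↦ Nat.zero_le _⟩
  g2 := fun π hπ ↦ by
    obtain ⟨X, Y, hX, hY, h⟩ := exists_isNestedFamily G M π hπ
    obtain ⟨⟨q, rfl⟩, hle⟩ := hY
    -- The minimal element generates modulo its own prime q, which already bounds the exponent of
    -- the quotient.
    obtain ⟨n, hn, hnL⟩ := exists_smul_mem_of_sup_modMul_eq_top (hX.generates q)
    refine ⟨X, X q, hX, ⟨⟨q, rfl⟩, hle⟩, fun p hp ↦ ?_, n, Nat.pos_of_ne_zero hn, fun v ↦ ?_⟩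
    · rw [sup_comm]
      exact h p hp
    · obtain ⟨m, rfl⟩ := Submodule.mkQ_surjective _ v
      rw [← map_nsmul, Submodule.mkQ_apply, Submodule.Quotient.mk_eq_zero]
      exact hnL m

end

theorem theorem7p1 (G : Type*) [Group G] [Finite G] (M : Type*) [AddCommGroup M]
    [Module (MonoidAlgebra ℤ G) M] [Module.Finite (MonoidAlgebra ℤ G) M] :
    (∀ π : Finset Nat.Primes, groupPrimes G ∪ addGroupPrimes M ⊂ (π : Set Nat.Primes) →
      ∃ (X : π → Set M) (Y : Set M), IsNestedFamily G π X ∧ IsMinimalElement X Y ∧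
        ∀ p : Nat.Primes, p ∉ π →
          genRank (MonoidAlgebra ℤ G) (M ⧸ (genBy G Y ⊔ modMul G M p)) ≤ 1) ∧
    IsGoodWith G M (groupPrimes G ∪ addGroupPrimes M) ∧
    IsGood G M :=
  ⟨exists_isNestedFamily G M, isGoodWith_groupPrimes_union_addGroupPrimes G M, _,
    isGoodWith_groupPrimes_union_addGroupPrimes G M⟩
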